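/- Let $S$ be a measure space and let $a,b:S\to[-\infty,\infty]$ be measurable functions with $\inf_{x\in S}(b(x)-a(x))>0$. Let $\mathcal B=\mathcal B(S,\mathbb R)$ be the Banach space of bounded measurable functions $f:S\to\mathbb R$ with norm $\|f\|_\infty=\sup_{x\in S}|f(x)|$, let $M=\{f\in\mathcal B: a(x)\le f(x)\le b(x)\ \forall x\in S\}$ with the metric $d(f,g)=\|f-g\|_\infty$, and let $V:M\to\mathcal B$ be locally Lipschitz. For $f\in M$ and $t\ge 0$ put $X_t(f)(x)=[f(x)+tV(f)(x)]_{a(x)}^{b(x)}$, where $[y]_\alpha^\beta=\min\{\max\{\alpha,y\},\beta\}$. Then: (1) $X$ is an arc field on $M$, i.e. $(f,t)\mapsto X_t(f)$ is a continuous map $M\times[0,1]\to M$ with $X_0=\mathrm{id}$, and it satisfies the following two conditions. (E1) For each $f_0\in M$ there are $r,\delta>0$ and $\Lambda\in\mathbb R$ with $d(X_t(f),X_t(g))\le(1+t\Lambda)\,d(f,g)$ for all $f,g\in B(f_0,r)$ and $0\le t<\delta$, $t\le 1$. (E2) For each $f_0\in M$ there are $r,\delta>0$ and $\Omega\in\mathbb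 R$ with $d(X_{s+t}(f),X_t(X_s(f)))\le st\,\Omega$ for all $f\in B(f_0,r)$ and $0\le t\le s<\delta$, $s+t\le1$. (2) $X$ has a unique (maximal) local forward flow. Here a local forward flow of $X$ is a function $T:M\to(0,\infty]$ such that $D_T=\{(f,t): 0\le t<T(f)\}$ is open in $M\times[0,\infty)$, together with a continuous map $F:D_T\to M$, $(f,t)\mapsto F_t(f)$, such that $F_0(f)=f$ and $F_t(F_s(f))=F_{s+t}(f)$ whenever both sides are defined, and which is forward tangent to $X$: $$\lim_{h\to0^+}\frac{d\big(F_{t+h}(f),X_h(F_t(f))\big)}{h}=0\qquad\text{for all }(f,t)\in D_T .$$ Precisely, there is a local forward flow $(T,F)$ of $X$ such that every local forward flow $(T',F')$ of $X$ is a restriction of it: $T'\le T$, and $F'_t(f)=F_t(f)$ for all $0\le t<T'(f)$. (3) $F$ is the limit of Euler curves: $F_t(f)=\lim_{n\to\infty}X_{t/n}^{(n)}(f)$ for all $f\in M$ and $0\le t<T(f)$, where $X_{t}^{(n)}$ is the $n$-fold composition of $X_{t}$ with itself. (4) If $V$ is globally Lipschitz, then $T(f)=\infty$ for all $f\in M$,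 so that $F:M\times[0,\infty)\to M$ is a forward flow of $X$ (continuous, $F_0=\mathrm{id}$, $F_t\circ F_s=F_{s+t}$ for all $s,t\ge0$, forward tangent to $X$), and it is the only one. -/

import Mathlib

open Filter Topology
open scoped NNReal ENNReal

namespace ArcField

section General

variable {M : Type*} [MetricSpace M]

/-- `X` is an arc field on `M`: a continuous map on `M × [0,1]` with `X₀ = id`.
Times are nonnegative reals; only the values of `X t` for `t ≤ 1` are constrained. -/
def IsArcField (X : ℝ≥0 → M → M) : Prop :=
  ContinuousOn (fun p : M × ℝ≥0 => X p.2 p.1) {p | p.2 ≤ 1} ∧ ∀ f, X 0 f = f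

/-- Condition E1 (local linear spread of the arc field). -/
def CondE1 (X : ℝ≥0 → M → M) : Prop :=
  ∀ f₀ : M, ∃ r > (0 : ℝ), ∃ δ > (0 : ℝ), ∃ Λ : ℝ,
    ∀ f ∈ Metric.ball f₀ r, ∀ g ∈ Metric.ball f₀ r, ∀ t : ℝ≥0, t ≤ 1 → (t : ℝ) < δ →
      dist (X t f) (X t g) ≤ (1 + t * Λ) * dist f g

/-- Condition E2 (the arc field is almost a flow). -/
def CondE2 (X : ℝ≥0 → M → M) : Prop :=
  ∀ f₀ : M, ∃ r > (0 : ℝ), ∃ δ > (0 : ℝ), ∃ Ω : ℝ,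
    ∀ f ∈ Metric.ball f₀ r, ∀ s t : ℝ≥0, t ≤ s → (s : ℝ) < δ → s + t ≤ 1 →
      dist (X (s + t) f) (X t (X s f)) ≤ s * t * Ω

/-- The curve `σ` is forward tangent to `X` at time `t`:
`d(σ(t + h), X_h(σ(t))) / h → 0` as `h → 0⁺`. -/
def ForwardTangentAt (X : ℝ≥0 → M → M) (σ : ℝ≥0 → M) (t : ℝ≥0) : Prop :=
  Tendsto (fun h : ℝ≥0 => dist (σ (t + h)) (X h (σ t)) / (h : ℝ)) (𝓝[>] 0) (𝓝 0)

/-- `F : M × [0,∞) → M` is a forward flow of the arc field `X`. -/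
structure IsFlowOf (X : ℝ≥0 → M → M) (F : ℝ≥0 → M → M) : Prop where
  continuous : Continuous (fun p : M × ℝ≥0 => F p.2 p.1)
  zero : ∀ f, F 0 f = f
  add : ∀ f s t, F t (F s f) = F (s + t) f
  tangent : ∀ f t, ForwardTangentAt X (fun u => F u f) t

/-- `F`, with lifetime function `T : M → (0,∞]`, is a local forward flow of the arc field `X`:
it is defined and continuous on the set `{(f,t) | 0 ≤ t < T f}`, which is open in `M × [0,∞)`,
it satisfies the flow identities wherever both sides are defined, and it is forward tangent to
`X`. The values of `F t f` for `t ≥ T f` are irrelevant. -/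
structure IsLocalFlowOf (X : ℝ≥0 → M → M) (T : M → ℝ≥0∞) (F : ℝ≥0 → M → M) : Prop where
  pos : ∀ f, 0 < T f
  isOpen_domain : IsOpen {p : M × ℝ≥0 | (p.2 : ℝ≥0∞) < T p.1}
  continuousOn : ContinuousOn (fun p : M × ℝ≥0 => F p.2 p.1) {p | (p.2 : ℝ≥0∞) < T p.1}
  zero : ∀ f, F 0 f = f
  add : ∀ (f : M) (s t : ℝ≥0), (s : ℝ≥0∞) < T f → (t : ℝ≥0∞) < T (F s f) →
    ((s + t : ℝ≥0) : ℝ≥0∞) < T f → F t (F s f) = F (s + t) f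
  tangent : ∀ (f : M) (t : ℝ≥0), (t : ℝ≥0∞) < T f → ForwardTangentAt X (fun u => F u f) t

end General

section Clip

/-- The clip `[x]_lo^hi = min (max lo x) hi` of a real number at extended real bounds.
It is a real number as soon as `lo < ∞` and `-∞ < hi`. -/
noncomputable def clip (lo hi : EReal) (x : ℝ) : ℝ := (min (max lo (x : EReal)) hi).toReal

theorem lt_of_sub_pos {lo hi : EReal} (h : 0 < hi - lo) : lo < hi := by
  by_contra hc
  have := EReal.sub_nonpos.2 (not_lt.1 hc)
  exact absurd h (not_lt.2 this)

theorem coe_clip {lo hi : EReal} (h : lo < hi) (x : ℝ) :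
    ((clip lo hi x : ℝ) : EReal) = min (max lo (x : EReal)) hi := by
  apply EReal.coe_toReal
  · exact (lt_of_le_of_lt (min_le_left _ _)
      (max_lt (lt_of_lt_of_le h le_top) (EReal.coe_lt_top x))).ne
  · exact (lt_min (lt_of_lt_of_le (EReal.bot_lt_coe x) (le_max_right _ _))
      (lt_of_le_of_lt bot_le h)).ne'

/-- A bound for the clip when the interval `[lo, hi]` contains the real number `y`. -/
theorem abs_clip_le {lo hi : EReal} (h : lo < hi) (x y : ℝ) (h₁ : lo ≤ y) (h₂ : (y : EReal) ≤ hi) :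
    |clip lo hi x| ≤ max |x| |y| := by
  have hc := coe_clip h x
  rcases le_total (max lo (x : EReal)) hi with h3 | h3
  · rw [min_eq_left h3] at hc
    rcases le_total lo (x : EReal) with h4 | h4
    · rw [max_eq_right h4] at hc
      rw [EReal.coe_eq_coe_iff.1 hc]
      exact le_max_left _ _
    · rw [max_eq_left h4] at hc
      rw [← hc] at h4 h₁
      exact abs_le_max_abs_abs (EReal.coe_le_coe_iff.1 h4) (EReal.coe_le_coe_iff.1 h₁)
  · rw [min_eq_right h3] at hc
    have h5 : (x : EReal) ≥ hi := by
      by_contra h6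
      exact absurd h3 (not_le.2 (max_lt h (not_le.1 h6)))
    rw [← hc] at h5 h₂
    rw [max_comm]
    exact abs_le_max_abs_abs (EReal.coe_le_coe_iff.1 h₂) (EReal.coe_le_coe_iff.1 h5)

variable (S : Type*) [MeasurableSpace S]

/-- The Banach space `ℬ(S,ℝ)` of bounded measurable functions `S → ℝ`, as a subspace of
the space `ℓ^∞` of all bounded functions with the norm `‖f‖ = sup |f|`. -/
def BddMeas : Submodule ℝ (lp (fun _ : S => ℝ) ∞) where
  carrier := {f | Measurable fun x => f x}
  add_mem' hf hg := Measurable.add hf hg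
  zero_mem' := measurable_const (a := (0 : ℝ))
  smul_mem' c _ hf := Measurable.const_smul hf c

variable {S}

/-- The metric space `M` (with the sup metric) of bounded measurable functions between the
barriers `a` and `b`. -/
def Between (a b : S → EReal) : Set (BddMeas S) :=
  {f | ∀ x, a x ≤ ((f.1 x : ℝ) : EReal) ∧ ((f.1 x : ℝ) : EReal) ≤ b x}

/-- The clipped arc field `X_t(f)(x) = [f(x) + t V(f)(x)]_{a(x)}^{b(x)}` on `M`. -/
noncomputable def clipArc (a b : S → EReal) (ha : Measurable a) (hb : Measurable b)
    (hab : 0 < ⨅ x, (b x - a x)) (V : Between a b → BddMeas S)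
    (t : ℝ≥0) (f : Between a b) : Between a b :=
  have hlt : ∀ x, a x < b x := fun x => lt_of_sub_pos (lt_of_lt_of_le hab (iInf_le _ x))
  ⟨⟨⟨fun x => clip (a x) (b x) (f.1.1 x + t * (V f).1 x), by
        refine memℓp_infty ⟨max (‖f.1.1‖ + t * ‖(V f).1‖) ‖f.1.1‖, ?_⟩
        rintro _ ⟨x, rfl⟩
        have h1 : |f.1.1 x| ≤ ‖f.1.1‖ := lp.norm_apply_le_norm ENNReal.top_ne_zero f.1.1 x
        have h2 : |(V f).1 x| ≤ ‖(V f).1‖ := lp.norm_apply_le_norm ENNReal.top_ne_zero (V f).1 x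
        refine (abs_clip_le (hlt x) _ _ (f.2 x).1 (f.2 x).2).trans (max_le_max ?_ h1)
        refine (abs_add_le _ _).trans (add_le_add h1 ?_)
        rw [abs_mul, NNReal.abs_eq]
        exact mul_le_mul_of_nonneg_left h2 t.coe_nonneg⟩, by
      have h1 : Measurable fun x => f.1.1 x := f.1.2
      have h2 : Measurable fun x => (V f).1 x := (V f).2
      exact ((ha.max (h1.add (h2.const_mul (t : ℝ))).coe_real_ereal).min hb).ereal_toReal⟩, by
    intro x
    change a x ≤ ((clip (a x) (b x) _ : ℝ) : EReal) ∧ ((clip (a x) (b x) _ : ℝ) : EReal) ≤ b x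
    rw [coe_clip (hlt x)]
    exact ⟨le_min (le_max_left _ _) (hlt x).le, min_le_right _ _⟩⟩

end Clip

end ArcField

open ArcField

namespace ArcField

/-! Clipping to an interval is nonexpansive, and clipped motion in a fixed direction is already a
semiflow (`clip_clip_add`). So if `V` is `K`-Lipschitz, `X_t` has Lipschitz constant at most `1 + K
t`, and `X_{s+t}` differs from `X_t ∘ X_s` only through the change of `V` between `f` and `X_s f`,
which costs at most `K s t ‖V f‖` (`isLipschitzArc_clipArc`).

These bounds drive the classical Euler argument in any complete metric space: the one-step error is
quadratic, the speed and the spread grow at most exponentially, so the errors over `[0, t]` add up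
to `O(1/n)`. The scheme converges to a global flow tangent to `X`. Tangent curves are unique by
Gronwall (`eqOn_of_tangent`).

For locally Lipschitz `V`, a cutoff makes `V` globally Lipschitz without changing it near a given
compact set (`exists_lipschitzWith_eqOn_of_isCompact`). Compact sets rather than points are needed
because the set used is the whole trace of a solution on `[0, t]`: the modified field then follows
that solution up to time `t`, and slightly beyond it for all nearby initial points
(`IsLocallyLipschitzArc.exists_flow_near`). This yields openness of the domain, joint continuity and
Euler convergence of the maximal flow, which is glued from all tangent curves. -/

/-- A globally controlled arc field: `X` has linear spread with constant `K`, speed at most `v`,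
and is almost a flow, with the defect controlled by `v`. -/
structure IsLipschitzArc {M : Type*} [MetricSpace M] (X : ℝ≥0 → M → M) (v : M → ℝ) (K : ℝ) :
    Prop where
  K_nonneg : 0 ≤ K
  v_nonneg : ∀ f, 0 ≤ v f
  v_cont : Continuous v
  zero : ∀ f, X 0 f = f
  spread : ∀ (t : ℝ≥0) f g, dist (X t f) (X t g) ≤ (1 + K * t) * dist f g
  speed : ∀ (s t : ℝ≥0) f, dist (X s f) (X t f) ≤ |(s : ℝ) - t| * v f
  defect : ∀ (s t : ℝ≥0) f, dist (X (s + t) f) (X t (X s f)) ≤ K * s * t * v f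
  growth : ∀ (t : ℝ≥0) f, v (X t f) ≤ (1 + K * t) * v f

/-! ### Euler scheme of a globally controlled arc field: error estimates. -/

namespace IsLipschitzArc

variable {M : Type*} [MetricSpace M] {X : ℝ≥0 → M → M} {v : M → ℝ} {K : ℝ}

theorem continuous (hX : IsLipschitzArc X v K) : Continuous (fun p : M × ℝ≥0 => X p.2 p.1) := by
  rw [continuous_iff_continuousAt]
  rintro ⟨f₀, t₀⟩
  rw [ContinuousAt, tendsto_iff_dist_tendsto_zero]
  have hlim : Tendsto (fun p : M × ℝ≥0 =>
      (1 + K * p.2) * dist p.1 f₀ + |(p.2 : ℝ) - t₀| * v f₀) (𝓝 (f₀, t₀)) (𝓝 0) := by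
    have : Continuous (fun p : M × ℝ≥0 =>
      (1 + K * p.2) * dist p.1 f₀ + |(p.2 : ℝ) - t₀| * v f₀) := by fun_prop
    simpa using this.tendsto (f₀, t₀)
  refine squeeze_zero (fun _ => dist_nonneg) (fun p => ?_) hlim
  exact (dist_triangle _ (X p.2 f₀) _).trans (add_le_add (hX.spread _ _ _) (hX.speed _ _ _))

theorem one_add_le_exp (K : ℝ) (h : ℝ≥0) : 1 + K * h ≤ Real.exp (K * h) := by
  linarith [Real.add_one_le_exp (K * h)]

theorem spread_iterate (hX : IsLipschitzArc X v K) (h : ℝ≥0) (n : ℕ) (f g : M) :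
    dist ((X h)^[n] f) ((X h)^[n] g) ≤ Real.exp (K * (n * h)) * dist f g := by
  induction n with
  | zero => simp
  | succ n ih =>
    rw [Function.iterate_succ_apply', Function.iterate_succ_apply']
    calc _ ≤ (1 + K * h) * dist ((X h)^[n] f) ((X h)^[n] g) := hX.spread _ _ _
      _ ≤ Real.exp (K * h) * (Real.exp (K * (n * h)) * dist f g) := by
        gcongr
        exact one_add_le_exp K h
      _ = _ := by
        rw [← mul_assoc, ← Real.exp_add]; push_cast; ring_nf

/-- Replaces a uniform bound on the speed: `v` may be unbounded, but along an orbit it grows at most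
exponentially in elapsed time. -/
theorem growth_iterate (hX : IsLipschitzArc X v K) (h : ℝ≥0) (n : ℕ) (f : M) :
    v ((X h)^[n] f) ≤ Real.exp (K * (n * h)) * v f := by
  induction n with
  | zero => simp
  | succ n ih =>
    rw [Function.iterate_succ_apply']
    calc _ ≤ (1 + K * h) * v ((X h)^[n] f) := hX.growth _ _
      _ ≤ Real.exp (K * h) * (Real.exp (K * (n * h)) * v f) := by
        have := hX.v_nonneg ((X h)^[n] f)
        gcongr
        exact one_add_le_exp K h
      _ = _ := by
        rw [← mul_assoc, ← Real.exp_add]; push_cast; ring_nf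

/-- Each further small step adds a defect `K (k h) h v f` and spreads the old error by `1 + K h`;
the squares close up because `k + k² ≤ (k + 1)²`. -/
theorem dist_step_iterate (hX : IsLipschitzArc X v K) (h : ℝ≥0) (k : ℕ) (f : M) :
    dist (X (k * h) f) ((X h)^[k] f) ≤ K * (k * h) ^ 2 * Real.exp (K * (k * h)) * v f := by
  have hK := hX.K_nonneg
  have hv := hX.v_nonneg f
  induction k with
  | zero => simp [hX.zero]
  | succ k ih =>
    rw [Function.iterate_succ_apply']
    have e : ((k + 1 : ℕ) : ℝ≥0) * h = k * h + h := by push_cast; ring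
    have hexp : Real.exp (K * ((k + 1 : ℕ) * h)) = Real.exp (K * h) * Real.exp (K * (k * h)) := by
      rw [← Real.exp_add]; push_cast; ring_nf
    have h1 : 1 ≤ Real.exp (K * h) := Real.one_le_exp (by positivity)
    have h2 : 1 ≤ Real.exp (K * (k * h)) := Real.one_le_exp (by positivity)
    have h3 : 1 ≤ Real.exp (K * h) * Real.exp (K * (k * h)) := one_le_mul_of_one_le_of_one_le h1 h2
    rw [e]
    calc _ ≤ dist (X (k * h + h) f) (X h (X (k * h) f)) +
          dist (X h (X (k * h) f)) (X h ((X h)^[k] f)) :=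
          dist_triangle _ _ _
      _ ≤ K * (k * h) * h * v f * 1 +
          Real.exp (K * h) * (K * (k * h) ^ 2 * Real.exp (K * (k * h)) * v f) := by
        refine add_le_add ?_ ((hX.spread _ _ _).trans ?_)
        · simpa using hX.defect (k * h) h f
        · gcongr
          exact one_add_le_exp K h
      _ ≤ K * (k * h) * h * v f * (Real.exp (K * h) * Real.exp (K * (k * h))) +
          Real.exp (K * h) * (K * (k * h) ^ 2 * Real.exp (K * (k * h)) * v f) := by gcongr
      _ = (K * (k * h) * h + K * (k * h) ^ 2) *
          (Real.exp (K * h) * Real.exp (K * (k * h))) * v f := by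
        ring
      _ ≤ K * ((k + 1 : ℕ) * h) ^ 2 * (Real.exp (K * h) * Real.exp (K * (k * h))) * v f := by
        gcongr
        push_cast
        have : 0 ≤ K * (h : ℝ) ^ 2 * (k + 1) := by positivity
        linear_combination this
      _ = _ := by rw [hexp]

/-- Local errors accumulate: each coarse step is refined at the cost of `dist_step_iterate` at the
current point, and the earlier error is carried along by the spread. -/
theorem dist_iterate_refine (hX : IsLipschitzArc X v K) (h : ℝ≥0) (m n : ℕ) (f : M) :
    dist ((X (m * h))^[n] f) ((X h)^[m * n] f) ≤
      n * (K * (m * h) ^ 2) * Real.exp (K * (n * (m * h))) * v f := by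
  have hK := hX.K_nonneg
  induction n with
  | zero => simp
  | succ n ih =>
    have hexp : Real.exp (K * ((n + 1 : ℕ) * (m * h))) =
        Real.exp (K * (m * h)) * Real.exp (K * (n * (m * h))) := by
      rw [← Real.exp_add]; push_cast; ring_nf
    have e : m * (n + 1) = m + m * n := by ring
    rw [Function.iterate_succ_apply', e, Function.iterate_add_apply]
    calc _ ≤ _ := dist_triangle _ ((X h)^[m] ((X (m * h))^[n] f)) _
      _ ≤ K * (m * h) ^ 2 * Real.exp (K * (m * h)) * (Real.exp (K * (n * (m * h))) * v f) +
          Real.exp (K * (m * h)) *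
            (n * (K * (m * h) ^ 2) * Real.exp (K * (n * (m * h))) * v f) := by
        refine add_le_add ((hX.dist_step_iterate _ _ _).trans ?_)
          ((hX.spread_iterate _ _ _ _).trans ?_)
        · gcongr
          simpa using hX.growth_iterate (m * h) n f
        · gcongr
      _ = _ := by rw [hexp]; push_cast; ring

/-- The error constant of the Euler scheme at time `t` from `f`. -/
noncomputable def errConst (v : M → ℝ) (K : ℝ) (t : ℝ≥0) (f : M) : ℝ :=
  K * t ^ 2 * Real.exp (K * t) * v f

theorem errConst_nonneg (hX : IsLipschitzArc X v K) (t : ℝ≥0) (f : M) :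
    0 ≤ errConst v K t f := by
  have := hX.K_nonneg
  have := hX.v_nonneg f
  unfold errConst
  positivity

theorem dist_euler_mul (hX : IsLipschitzArc X v K) (t : ℝ≥0) (f : M) {n m : ℕ} (hn : n ≠ 0)
    (hm : m ≠ 0) : dist ((X (t / n))^[n] f) ((X (t / (n * m : ℕ)))^[n * m] f) ≤
      errConst v K t f / n := by
  have h := hX.dist_iterate_refine (t / (n * m : ℕ)) m n f
  have hn' : (n : ℝ) ≠ 0 := by exact_mod_cast hn
  have hm' : (m : ℝ) ≠ 0 := by exact_mod_cast hm
  have e : (m : ℝ≥0) * (t / (n * m : ℕ)) = t / n := by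
    have hn' : (n : ℝ≥0) ≠ 0 := by exact_mod_cast hn
    have hm' : (m : ℝ≥0) ≠ 0 := by exact_mod_cast hm
    push_cast
    field_simp
  rw [e, mul_comm m n] at h
  refine h.trans (le_of_eq ?_)
  have e' : (m : ℝ) * ((t / (n * m : ℕ) : ℝ≥0) : ℝ) = t / n := by
    exact_mod_cast congrArg NNReal.toReal e
  rw [e', errConst]
  have e2 : (n : ℝ) * (t / n) = t := by field_simp
  rw [e2]
  field_simp

/-- The subdivisions into `n` and `m` steps are compared through their common refinement into `n *
m` steps. -/
theorem dist_euler_euler (hX : IsLipschitzArc X v K) (t : ℝ≥0) (f : M) {n m : ℕ} (hn : n ≠ 0)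
    (hm : m ≠ 0) : dist ((X (t / n))^[n] f) ((X (t / m))^[m] f) ≤
      errConst v K t f / n + errConst v K t f / m := by
  refine (dist_triangle_right _ _ ((X (t / (n * m : ℕ)))^[n * m] f)).trans ?_
  refine add_le_add (hX.dist_euler_mul t f hn hm) ?_
  rw [mul_comm n m]
  exact hX.dist_euler_mul t f hm hn

theorem exists_tendsto_euler [CompleteSpace M] (hX : IsLipschitzArc X v K) (t : ℝ≥0) (f : M) :
    ∃ g, Tendsto (fun n : ℕ => (X (t / n))^[n] f) atTop (𝓝 g) := by
  apply cauchySeq_tendsto_of_complete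
  have hC := hX.errConst_nonneg t f
  -- The zeroth term is `f` itself (no iterations), outside the error estimate, so it gets its own
  -- bound.
  refine cauchySeq_of_le_tendsto_0' (fun n : ℕ => if n = 0 then
    (dist f ((X (t / 1))^[1] f) + 2 * errConst v K t f) else 2 * errConst v K t f / n) ?_ ?_
  · intro n m hnm
    rcases eq_or_ne n 0 with rfl | hn
    · simp only [if_true]
      rcases eq_or_ne m 0 with rfl | hm
      · simp; positivity
      · refine (dist_triangle _ ((X (t / 1))^[1] f) _).trans ?_
        have h1 := hX.dist_euler_euler t f one_ne_zero hm
        have h2 : errConst v K t f / m ≤ errConst v K t f :=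
          div_le_self hC (by exact_mod_cast Nat.one_le_iff_ne_zero.2 hm)
        simp only [Nat.cast_one, div_one, Function.iterate_zero, id, Function.iterate_one] at h1 ⊢
        linarith
    · have hm : m ≠ 0 := by omega
      simp only [if_neg hn]
      refine (hX.dist_euler_euler t f hn hm).trans ?_
      have : errConst v K t f / m ≤ errConst v K t f / n := by
        have : 0 < n := by omega
        gcongr
      rw [two_mul, add_div]
      linarith
  · refine (tendsto_const_div_atTop_nhds_zero_nat (2 * errConst v K t f)).congr' ?_
    filter_upwards [eventually_ne_atTop 0] with n hn
    simp [hn]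

theorem continuous_iterate (hX : IsLipschitzArc X v K) (c : ℝ≥0) (n : ℕ) (f : M) :
    Continuous fun t : ℝ≥0 => (X (t / c))^[n] f := by
  induction n with
  | zero => exact continuous_const
  | succ n ih =>
    simp only [Function.iterate_succ_apply']
    exact hX.continuous.comp (ih.prodMk (continuous_id.div_const c))

theorem tendsto_floor_grid (s : ℝ≥0) :
    Tendsto (fun n : ℕ => (⌊s * n⌋₊ : ℝ≥0) * (1 / n)) atTop (𝓝 s) := by
  have h := (tendsto_nat_floor_mul_div_atTop (R := ℝ) s.coe_nonneg).comp
    tendsto_natCast_atTop_atTop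
  rw [← NNReal.tendsto_coe]
  refine h.congr fun n => ?_
  have : ⌊(s : ℝ) * n⌋₊ = ⌊s * n⌋₊ := by
    rw [← NNReal.coe_natCast, ← NNReal.coe_mul]
    exact Nonneg.nat_floor_coe _
  simp [this, div_eq_mul_inv]

/-! ### The limit flow of a globally controlled arc field. -/

variable [CompleteSpace M]

/-- The flow of a globally controlled arc field, as the limit of the Euler scheme. -/
noncomputable def flow (hX : IsLipschitzArc X v K) (t : ℝ≥0) (f : M) : M :=
  (hX.exists_tendsto_euler t f).choose

theorem tendsto_flow (hX : IsLipschitzArc X v K) (t : ℝ≥0) (f : M) :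
    Tendsto (fun n : ℕ => (X (t / n))^[n] f) atTop (𝓝 (hX.flow t f)) :=
  (hX.exists_tendsto_euler t f).choose_spec

theorem dist_euler_flow (hX : IsLipschitzArc X v K) (t : ℝ≥0) (f : M) {n : ℕ} (hn : n ≠ 0) :
    dist ((X (t / n))^[n] f) (hX.flow t f) ≤ errConst v K t f / n := by
  have h1 := (tendsto_const_nhds (x := (X (t / n))^[n] f)).dist (hX.tendsto_flow t f)
  have h2 : Tendsto (fun m : ℕ => errConst v K t f / n + errConst v K t f / m) atTop
      (𝓝 (errConst v K t f / n + 0)) :=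
    tendsto_const_nhds.add (tendsto_const_div_atTop_nhds_zero_nat _)
  rw [add_zero] at h2
  refine le_of_tendsto_of_tendsto h1 h2 ?_
  filter_upwards [eventually_ne_atTop 0] with m hm
  exact hX.dist_euler_euler t f hn hm

theorem flow_zero (hX : IsLipschitzArc X v K) (f : M) : hX.flow 0 f = f := by
  have h := hX.dist_euler_flow 0 f one_ne_zero
  simp only [Nat.cast_one, div_one, Function.iterate_one, hX.zero, errConst, NNReal.coe_zero] at h
  have : dist f (hX.flow 0 f) ≤ 0 := by simpa using h
  exact (dist_le_zero.1 this).symm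

/-- The Euler error at time `k h` with `k` steps, rewritten so that it is visibly first order in the
step `h`. -/
theorem dist_iterate_flow (hX : IsLipschitzArc X v K) (h : ℝ≥0) (k : ℕ) (f : M) :
    dist ((X h)^[k] f) (hX.flow (k * h) f) ≤ K * (k * h) * h * Real.exp (K * (k * h)) * v f := by
  rcases eq_or_ne k 0 with rfl | hk
  · simp [hX.flow_zero]
  · have h1 := hX.dist_euler_flow (k * h) f hk
    have hk' : (k : ℝ≥0) ≠ 0 := by exact_mod_cast hk
    have hk2 : (k : ℝ) ≠ 0 := by exact_mod_cast hk
    rw [mul_div_cancel_left₀ _ hk'] at h1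
    refine h1.trans (le_of_eq ?_)
    rw [errConst]
    push_cast
    field_simp

theorem spread_flow (hX : IsLipschitzArc X v K) (t : ℝ≥0) (f g : M) :
    dist (hX.flow t f) (hX.flow t g) ≤ Real.exp (K * t) * dist f g := by
  refine le_of_tendsto ((hX.tendsto_flow t f).dist (hX.tendsto_flow t g)) ?_
  filter_upwards [eventually_ne_atTop 0] with n hn
  have h := hX.spread_iterate (t / n) n f g
  have hn2 : (n : ℝ) ≠ 0 := by exact_mod_cast hn
  have e : (n : ℝ) * ((t / n : ℝ≥0) : ℝ) = t := by push_cast; field_simp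
  rwa [e] at h

/-- The Euler approximants are continuous in time and converge uniformly on bounded time intervals,
since `errConst` is monotone in `t`. -/
theorem continuous_flow_time (hX : IsLipschitzArc X v K) (f : M) :
    Continuous fun t => hX.flow t f := by
  refine continuous_iff_continuousAt.2 fun t₀ => ?_
  refine continuousAt_of_locally_uniform_approx_of_continuousAt fun u hu => ?_
  obtain ⟨ε, hε, hu⟩ := Metric.mem_uniformity_dist.1 hu
  have hK := hX.K_nonneg
  have hv := hX.v_nonneg f
  obtain ⟨n, hn⟩ := exists_nat_gt (errConst v K (t₀ + 1) f / ε)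
  have hn0 : (0 : ℝ) < n := (div_nonneg (hX.errConst_nonneg _ _) hε.le).trans_lt hn
  refine ⟨{t | t < t₀ + 1}, (isOpen_gt' _).mem_nhds (by simp), fun t => (X (t / n))^[n] f,
    (hX.continuous_iterate _ _ _).continuousAt, fun t ht => hu ?_⟩
  rw [dist_comm]
  refine (hX.dist_euler_flow t f (by exact_mod_cast hn0.ne')).trans_lt ?_
  have h1 : errConst v K t f ≤ errConst v K (t₀ + 1) f := by
    have : (t : ℝ) ≤ (t₀ + 1 : ℝ≥0) := by exact_mod_cast (le_of_lt ht)
    unfold errConst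
    gcongr
  rw [div_lt_iff₀ hε] at hn
  rw [div_lt_iff₀ hn0]
  linarith

theorem continuous_flow (hX : IsLipschitzArc X v K) :
    Continuous (fun p : M × ℝ≥0 => hX.flow p.2 p.1) := by
  rw [continuous_iff_continuousAt]
  rintro ⟨f₀, t₀⟩
  rw [ContinuousAt, tendsto_iff_dist_tendsto_zero]
  have hlim : Tendsto (fun p : M × ℝ≥0 =>
      Real.exp (K * p.2) * dist p.1 f₀ + dist (hX.flow p.2 f₀) (hX.flow t₀ f₀))
      (𝓝 (f₀, t₀)) (𝓝 0) := by
    have h1 := hX.continuous_flow_time f₀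
    have : Continuous (fun p : M × ℝ≥0 =>
      Real.exp (K * p.2) * dist p.1 f₀ + dist (hX.flow p.2 f₀) (hX.flow t₀ f₀)) :=
      (by fun_prop : Continuous fun p : M × ℝ≥0 => Real.exp (K * p.2) * dist p.1 f₀).add
        ((h1.comp continuous_snd).dist continuous_const)
    simpa using this.tendsto (f₀, t₀)
  refine squeeze_zero (fun _ => dist_nonneg) (fun p => ?_) hlim
  exact (dist_triangle _ (hX.flow p.2 f₀) _).trans (by gcongr; exact hX.spread_flow _ _ _)

/-- On a common grid the iterates compose exactly; the factor 3 counts the three replacements of an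
iterate by the flow. -/
theorem dist_flow_add_grid (hX : IsLipschitzArc X v K) (h : ℝ≥0) (k l : ℕ) (f : M) :
    dist (hX.flow (l * h) (hX.flow (k * h) f)) (hX.flow (k * h + l * h) f) ≤
      3 * (K * (k * h + l * h) * h * Real.exp (K * (k * h + l * h)) * v f) := by
  have hK := hX.K_nonneg
  have hv := hX.v_nonneg f
  have a1 := hX.dist_iterate_flow h k f
  have a2 := hX.dist_iterate_flow h l ((X h)^[k] f)
  have a3 := hX.dist_iterate_flow h (l + k) f
  rw [Function.iterate_add_apply] at a3
  have a4 := hX.spread_flow (l * h) (hX.flow (k * h) f) ((X h)^[k] f)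
  have e : ((l + k : ℕ) : ℝ≥0) * h = k * h + l * h := by push_cast; ring
  have e' : ((l + k : ℕ) : ℝ) * h = k * h + l * h := by push_cast; ring
  rw [e, e'] at a3
  have hexp : Real.exp (K * (l * h)) * Real.exp (K * (k * h)) =
      Real.exp (K * (k * h + l * h)) := by rw [← Real.exp_add]; ring_nf
  have b2 : dist ((X h)^[l] ((X h)^[k] f)) (hX.flow (l * h) ((X h)^[k] f)) ≤
      K * (k * h + l * h) * h * Real.exp (K * (k * h + l * h)) * v f := by
    refine a2.trans ?_
    calc _ ≤ K * (l * h) * h * Real.exp (K * (l * h)) * (Real.exp (K * (k * h)) * v f) := by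
          gcongr
          exact hX.growth_iterate h k f
      _ = K * (0 + l * h) * h * Real.exp (K * (k * h + l * h)) * v f := by rw [← hexp]; ring
      _ ≤ _ := by gcongr; positivity
  have b4 : dist (hX.flow (l * h) (hX.flow (k * h) f)) (hX.flow (l * h) ((X h)^[k] f)) ≤
      K * (k * h + l * h) * h * Real.exp (K * (k * h + l * h)) * v f := by
    refine a4.trans ?_
    rw [dist_comm]
    push_cast
    calc _ ≤ Real.exp (K * (l * h)) * (K * (k * h) * h * Real.exp (K * (k * h)) * v f) := by
          gcongr
      _ = K * (k * h + 0) * h * Real.exp (K * (k * h + l * h)) * v f := by rw [← hexp]; ring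
      _ ≤ _ := by gcongr; positivity
  have t1 := dist_triangle (hX.flow (l * h) (hX.flow (k * h) f)) (hX.flow (l * h) ((X h)^[k] f))
    (hX.flow (k * h + l * h) f)
  have t2 := dist_triangle_left (hX.flow (l * h) ((X h)^[k] f))
    (hX.flow (k * h + l * h) f) ((X h)^[l] ((X h)^[k] f))
  linarith

/-- Arbitrary `s` and `t` may be incommensurable, so both are rounded down to multiples of `1 / n`,
where the defect is `O(1/n)`; joint continuity gives the limit. -/
theorem flow_add (hX : IsLipschitzArc X v K) (f : M) (s t : ℝ≥0) :
    hX.flow t (hX.flow s f) = hX.flow (s + t) f := by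
  have hs := tendsto_floor_grid s
  have ht := tendsto_floor_grid t
  have h1 : Tendsto (fun n : ℕ => hX.flow ((⌊s * n⌋₊ : ℝ≥0) * (1 / n)) f) atTop
      (𝓝 (hX.flow s f)) := (hX.continuous_flow_time f).continuousAt.tendsto.comp hs
  have h2 := (hX.continuous_flow.tendsto (hX.flow s f, t)).comp (h1.prodMk_nhds ht)
  have h3 := ((hX.continuous_flow_time f).tendsto (s + t)).comp (hs.add ht)
  have h4 := h2.dist h3
  have hs' := (NNReal.tendsto_coe.2 hs)
  have ht' := (NNReal.tendsto_coe.2 ht)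
  have hh : Tendsto (fun n : ℕ => ((1 / n : ℝ≥0) : ℝ)) atTop (𝓝 0) := by
    simpa using tendsto_one_div_atTop_nhds_zero_nat (𝕜 := ℝ)
  have hst := hs'.add ht'
  have h5 := (((((hst.const_mul K).mul hh).mul
    ((Real.continuous_exp.tendsto _).comp (hst.const_mul K))).mul_const (v f)).const_mul 3)
  have h6 := le_of_tendsto_of_tendsto' h4 h5 (fun n => by
    have := hX.dist_flow_add_grid (1 / n) ⌊s * n⌋₊ ⌊t * n⌋₊ f
    push_cast at this ⊢
    simpa using this)
  simpa using h6

theorem dist_flow_step (hX : IsLipschitzArc X v K) (h : ℝ≥0) (f : M) :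
    dist (hX.flow h f) (X h f) ≤ K * h ^ 2 * Real.exp (K * h) * v f := by
  have := hX.dist_iterate_flow h 1 f
  rw [dist_comm]
  simpa [sq, mul_assoc] using this

/-- The flow property moves the base point to time zero, where the one-step error is quadratic in
`h`. -/
theorem flow_tangent (hX : IsLipschitzArc X v K) (f : M) (t : ℝ≥0) :
    ForwardTangentAt X (fun u => hX.flow u f) t := by
  have hlim : Tendsto (fun h : ℝ≥0 => K * h * Real.exp (K * h) * v (hX.flow t f)) (𝓝[>] 0)
      (𝓝 0) := by
    have : Continuous (fun h : ℝ≥0 => K * h * Real.exp (K * h) * v (hX.flow t f)) := by fun_prop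
    simpa using (this.tendsto 0).mono_left nhdsWithin_le_nhds
  refine squeeze_zero' (Eventually.of_forall fun h => by positivity) ?_ hlim
  filter_upwards [self_mem_nhdsWithin] with h hh
  have hh' : (0 : ℝ) < h := by exact_mod_cast hh
  rw [div_le_iff₀ hh', ← hX.flow_add]
  refine (hX.dist_flow_step h _).trans (le_of_eq ?_)
  ring

theorem isFlowOf (hX : IsLipschitzArc X v K) : IsFlowOf X hX.flow where
  continuous := hX.continuous_flow
  zero := hX.flow_zero
  add := hX.flow_add
  tangent := hX.flow_tangent

end IsLipschitzArc

/-! ### Uniqueness of forward tangent curves. -/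

section Uniqueness

variable {M : Type*} [MetricSpace M] {X : ℝ≥0 → M → M}

theorem tendsto_toNNReal_sub (w : ℝ≥0) :
    Tendsto (fun z : ℝ => (z - w).toNNReal) (𝓝[>] (w : ℝ)) (𝓝[>] 0) := by
  refine tendsto_nhdsWithin_iff.2 ⟨?_, ?_⟩
  · have : Continuous (fun z : ℝ => (z - w).toNNReal) := by fun_prop
    simpa using (this.tendsto w).mono_left nhdsWithin_le_nhds
  · filter_upwards [self_mem_nhdsWithin] with z hz
    simpa using hz

/-- Two forward tangent curves along which the arc field has linear spread agree as soon as they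
agree initially. -/
theorem eqOn_of_tangent_of_spread {σ τ : ℝ≥0 → M} {a b : ℝ≥0} {Λ : ℝ}
    (hσ : ContinuousOn σ (Set.Icc a b)) (hτ : ContinuousOn τ (Set.Icc a b))
    (hσX : ∀ u ∈ Set.Ico a b, ForwardTangentAt X σ u)
    (hτX : ∀ u ∈ Set.Ico a b, ForwardTangentAt X τ u)
    (hX : ∀ u ∈ Set.Ico a b, ∀ᶠ h : ℝ≥0 in 𝓝[>] 0,
      dist (X h (σ u)) (X h (τ u)) ≤ (1 + h * Λ) * dist (σ u) (τ u))
    (h₀ : σ a = τ a) : Set.EqOn σ τ (Set.Icc a b) := by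
  set φ : ℝ → ℝ := fun y => dist (σ y.toNNReal) (τ y.toNNReal) with hφ
  have hmaps : Set.MapsTo Real.toNNReal (Set.Icc (a : ℝ) b) (Set.Icc a b) := by
    intro y hy
    exact ⟨NNReal.le_toNNReal_of_coe_le hy.1, Real.toNNReal_le_iff_le_coe.2 hy.2⟩
  have hcont : ContinuousOn φ (Set.Icc a b) :=
    continuous_dist.comp_continuousOn
      ((hσ.comp continuous_real_toNNReal.continuousOn hmaps).prodMk
        (hτ.comp continuous_real_toNNReal.continuousOn hmaps))
  have key := le_gronwallBound_of_liminf_deriv_right_le (f := φ) (f' := fun y => Λ * φ y)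
    (δ := 0) (K := Λ) (ε := 0) hcont ?_ (by simp [hφ, h₀]) (fun _ _ => by simp)
  · intro u hu
    have := key u ⟨by exact_mod_cast hu.1, by exact_mod_cast hu.2⟩
    rw [gronwallBound_ε0_δ0] at this
    simpa [hφ] using this
  · intro y hy r hr
    have hy0 : 0 ≤ y := a.coe_nonneg.trans hy.1
    lift y to ℝ≥0 using hy0 with w
    have hw : w ∈ Set.Ico a b := ⟨by exact_mod_cast hy.1, by exact_mod_cast hy.2⟩
    refine Eventually.frequently ?_
    -- The gap between `r` and `Λ * φ w` absorbs the two tangency errors, which bounds the right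
    -- difference quotient of `φ` by `r`. Gronwall then applies with zero initial value.
    have hlim := (hσX w hw).add (hτX w hw)
    rw [add_zero] at hlim
    have e1 := hlim.eventually (gt_mem_nhds (sub_pos.2 hr))
    filter_upwards [(tendsto_toNNReal_sub w).eventually (e1.and (hX w hw)),
      self_mem_nhdsWithin] with z hz hzw
    obtain ⟨hz1, hz2⟩ := hz
    have hzw' : 0 < z - w := sub_pos.2 hzw
    set h := (z - w).toNNReal with hh
    have hhz : (h : ℝ) = z - w := Real.coe_toNNReal _ hzw'.le
    have hz' : z.toNNReal = w + h := by
      have : z = ((w + h : ℝ≥0) : ℝ) := by push_cast; rw [hhz]; ring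
      rw [this, Real.toNNReal_coe]
    have hpos : (0 : ℝ) < h := by rw [hhz]; exact hzw'
    rw [← hhz, inv_mul_eq_div, div_lt_iff₀ hpos]
    rw [← add_div, div_lt_iff₀ hpos] at hz1
    simp only [hφ, hz', Real.toNNReal_coe] at hz1 ⊢
    have t := dist_triangle4 (σ (w + h)) (X h (σ w)) (X h (τ w)) (τ (w + h))
    rw [dist_comm (X h (τ w)) (τ (w + h))] at t
    linarith

/-- Under linear spread, forward tangent curves are determined by their initial value. -/
theorem eqOn_of_tangent (hE : CondE1 X) {σ τ : ℝ≥0 → M} {b : ℝ≥0}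
    (hσ : ContinuousOn σ (Set.Icc 0 b)) (hτ : ContinuousOn τ (Set.Icc 0 b))
    (hσX : ∀ u < b, ForwardTangentAt X σ u) (hτX : ∀ u < b, ForwardTangentAt X τ u)
    (h₀ : σ 0 = τ 0) : Set.EqOn σ τ (Set.Icc 0 b) := by
  have hclosed : IsClosed ({t | σ t = τ t} ∩ Set.Icc 0 b) := by
    have := (hσ.prodMk hτ).preimage_isClosed_of_isClosed isClosed_Icc isClosed_diagonal
    convert this using 1
    ext t
    simp [and_comm]
  -- Continuous induction: the coincidence set is closed, and from a coincidence at `x` both curves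
  -- stay for a while in the E1 ball around `σ x`, where the Gronwall argument applies.
  refine hclosed.Icc_subset_of_forall_mem_nhdsWithin h₀ ?_
  rintro x ⟨hx, hxb⟩
  obtain ⟨r, hr, δ, hδ, Λ, hE⟩ := hE (σ x)
  have hball : ∀ ρ : ℝ≥0 → M, ContinuousOn ρ (Set.Icc 0 b) → ρ x = σ x →
      ∀ᶠ u in 𝓝[≥] x, ρ u ∈ Metric.ball (σ x) r := by
    intro ρ hρ hρx
    have h1 : ContinuousWithinAt ρ (Set.Icc x b) x :=
      (hρ x ⟨zero_le, hxb.2.le⟩).mono (Set.Icc_subset_Icc_left zero_le)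
    rw [← nhdsWithin_Icc_eq_nhdsGE hxb.2]
    exact h1.eventually (by rw [hρx]; exact Metric.ball_mem_nhds _ hr)
  have hev := (hball σ hσ rfl).and (hball τ hτ hx.symm)
  obtain ⟨c, ⟨hc, -⟩, hcs⟩ := (mem_nhdsGE_iff_exists_mem_Ioc_Ico_subset hxb.2).1 hev
  set d := min c b with hd
  have hxd : x < d := lt_min hc hxb.2
  have heq := eqOn_of_tangent_of_spread (X := X) (Λ := Λ) (a := x) (b := d)
    (hσ.mono (Set.Icc_subset_Icc zero_le (min_le_right _ _)))
    (hτ.mono (Set.Icc_subset_Icc zero_le (min_le_right _ _)))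
    (fun u hu => hσX u (hu.2.trans_le (min_le_right _ _)))
    (fun u hu => hτX u (hu.2.trans_le (min_le_right _ _))) ?_ hx
  · filter_upwards [Ioc_mem_nhdsGT hxd] with u hu using heq ⟨hu.1.le, hu.2⟩
  · intro u hu
    have hu' := hcs ⟨hu.1, hu.2.trans_le (min_le_left _ _)⟩
    have h1 : ∀ᶠ h : ℝ≥0 in 𝓝[>] 0, h < 1 := nhdsWithin_le_nhds (gt_mem_nhds one_pos)
    have h2 : ∀ᶠ h : ℝ≥0 in 𝓝[>] 0, (h : ℝ) < δ :=
      nhdsWithin_le_nhds (NNReal.continuous_coe.continuousAt.eventually (gt_mem_nhds hδ))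
    filter_upwards [h1, h2] with h h1 h2
    exact hE _ hu'.1 _ hu'.2 h h1.le h2

end Uniqueness

/-! ### Localization: comparing `X` with globally controlled fields. -/

theorem iterate_eq_of_forall_mem {M : Type*} {X X' : ℝ≥0 → M → M} {U : Set M}
    (heq : ∀ f ∈ U, ∀ t, X t f = X' t f) {h : ℝ≥0} {f : M} {n : ℕ}
    (hU : ∀ k < n, (X' h)^[k] f ∈ U) : (X h)^[n] f = (X' h)^[n] f := by
  induction n with
  | zero => rfl
  | succ n ih =>
    rw [Function.iterate_succ_apply', Function.iterate_succ_apply',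
      ih fun k hk => hU k (hk.trans n.lt_succ_self), heq _ (hU n n.lt_succ_self)]

section LocalTheory

variable {M : Type*} [MetricSpace M] {X : ℝ≥0 → M → M}

/-- Near each compact set, `X` agrees with a globally controlled arc field. -/
def IsLocallyLipschitzArc (X : ℝ≥0 → M → M) : Prop :=
  ∀ C : Set M, IsCompact C → ∃ (X' : ℝ≥0 → M → M) (v : M → ℝ) (K : ℝ), IsLipschitzArc X' v K ∧
    ∃ U : Set M, IsOpen U ∧ C ⊆ U ∧ ∀ f ∈ U, ∀ t, X t f = X' t f

theorem IsLocallyLipschitzArc.isArcField (hX : IsLocallyLipschitzArc X) : IsArcField X := by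
  refine ⟨Continuous.continuousOn (continuous_iff_continuousAt.2 fun p => ?_), fun f => ?_⟩
  · obtain ⟨X', v, K, hX', U, hU, hCU, heq⟩ := hX {p.1} isCompact_singleton
    refine hX'.continuous.continuousAt.congr ?_
    have : ∀ᶠ q : M × ℝ≥0 in 𝓝 p, q.1 ∈ U :=
      continuous_fst.continuousAt.eventually (hU.mem_nhds (hCU rfl))
    filter_upwards [this] with q hq using (heq _ hq _).symm
  · obtain ⟨X', v, K, hX', U, hU, hCU, heq⟩ := hX {f} isCompact_singleton
    rw [heq f (hCU rfl), hX'.zero]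

theorem IsLocallyLipschitzArc.condE1 (hX : IsLocallyLipschitzArc X) : CondE1 X := by
  intro f₀
  obtain ⟨X', v, K, hX', U, hU, hCU, heq⟩ := hX {f₀} isCompact_singleton
  obtain ⟨r, hr, hrU⟩ := Metric.isOpen_iff.1 hU f₀ (hCU rfl)
  refine ⟨r, hr, 1, one_pos, K, fun f hf g hg t _ _ => ?_⟩
  rw [heq f (hrU hf), heq g (hrU hg), mul_comm (t : ℝ)]
  exact hX'.spread t f g

theorem IsLocallyLipschitzArc.condE2 (hX : IsLocallyLipschitzArc X) : CondE2 X := by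
  intro f₀
  obtain ⟨X', v, K, hX', U, hU, hCU, heq⟩ := hX {f₀} isCompact_singleton
  have hf₀ : f₀ ∈ U := hCU rfl
  -- The defect bound transfers to `X` only if `X' s f` also lies in `U`; a bound on `v` near `f₀`
  -- makes the constant uniform.
  have h1 : ∀ᶠ p : M × ℝ≥0 in 𝓝 (f₀, 0), p.1 ∈ U ∧ X' p.2 p.1 ∈ U ∧ v p.1 < v f₀ + 1 := by
    have hfst : ∀ᶠ p : M × ℝ≥0 in 𝓝 (f₀, 0), p.1 ∈ U :=
      (hU.preimage continuous_fst).mem_nhds hf₀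
    refine hfst.and
      ((hX'.continuous.continuousAt.eventually (hU.mem_nhds ?_)).and
      ((hX'.v_cont.comp continuous_fst).continuousAt.eventually (gt_mem_nhds (lt_add_one _))))
    simpa [hX'.zero] using hf₀
  obtain ⟨r, hr, hr'⟩ := Metric.eventually_nhds_iff.1 h1
  refine ⟨r, hr, r, hr, K * (v f₀ + 1), fun f hf s t _ hs _ => ?_⟩
  have hfs : dist (f, s) (f₀, (0 : ℝ≥0)) < r := by
    rw [Prod.dist_eq, max_lt_iff]
    exact ⟨hf, by simpa [NNReal.dist_eq] using hs⟩
  obtain ⟨hfU, hsU, hv⟩ := hr' hfs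
  rw [heq f hfU, heq f hfU, heq _ hsU]
  refine (hX'.defect s t f).trans ?_
  have hK := hX'.K_nonneg
  have : K * s * t * v f ≤ K * s * t * (v f₀ + 1) := by
    have := hv.le
    gcongr
  linarith

/-- `σ` is a forward tangent curve of `X` on `[0, c)`. -/
def IsSolution (X : ℝ≥0 → M → M) (σ : ℝ≥0 → M) (c : ℝ≥0∞) : Prop :=
  ContinuousOn σ {t | (t : ℝ≥0∞) < c} ∧ ∀ t : ℝ≥0, (t : ℝ≥0∞) < c → ForwardTangentAt X σ t

theorem isOpen_setOf_coe_lt (c : ℝ≥0∞) : IsOpen {t : ℝ≥0 | (t : ℝ≥0∞) < c} :=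
  isOpen_lt ENNReal.continuous_coe continuous_const

theorem ForwardTangentAt.congr_field {X' : ℝ≥0 → M → M} {σ : ℝ≥0 → M} {t : ℝ≥0}
    (h : ForwardTangentAt X σ t) (heq : ∀ s, X s (σ t) = X' s (σ t)) :
    ForwardTangentAt X' σ t := by
  simpa [ForwardTangentAt, heq] using h

theorem ForwardTangentAt.congr_curve {σ τ : ℝ≥0 → M} {t : ℝ≥0}
    (h : ForwardTangentAt X σ t) (heq : σ =ᶠ[𝓝 t] τ) : ForwardTangentAt X τ t := by
  refine Tendsto.congr' ?_ h
  have h1 : Tendsto (fun h : ℝ≥0 => t + h) (𝓝[>] 0) (𝓝 t) := by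
    have : Continuous fun h : ℝ≥0 => t + h := by fun_prop
    simpa using (this.tendsto 0).mono_left nhdsWithin_le_nhds
  filter_upwards [h1.eventually heq] with h hh
  rw [hh, heq.self_of_nhds]

theorem ForwardTangentAt.shift {σ : ℝ≥0 → M} {s t : ℝ≥0}
    (h : ForwardTangentAt X σ (s + t)) : ForwardTangentAt X (fun u => σ (s + u)) t := by
  simpa [ForwardTangentAt, add_assoc] using h

theorem Icc_subset_setOf_coe_lt {t : ℝ≥0} {c : ℝ≥0∞} (ht : (t : ℝ≥0∞) < c) :
    Set.Icc 0 t ⊆ {u : ℝ≥0 | (u : ℝ≥0∞) < c} :=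
  fun _ hu => lt_of_le_of_lt (by exact_mod_cast hu.2) ht

theorem IsSolution.eq (hE : CondE1 X) {σ τ : ℝ≥0 → M} {c d : ℝ≥0∞} (hσ : IsSolution X σ c)
    (hτ : IsSolution X τ d) (h₀ : σ 0 = τ 0) {t : ℝ≥0} (hc : (t : ℝ≥0∞) < c)
    (hd : (t : ℝ≥0∞) < d) : σ t = τ t :=
  eqOn_of_tangent hE (hσ.1.mono (Icc_subset_setOf_coe_lt hc))
    (hτ.1.mono (Icc_subset_setOf_coe_lt hd))
    (fun _ hu => hσ.2 _ (Icc_subset_setOf_coe_lt hc ⟨zero_le, hu.le⟩))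
    (fun _ hu => hτ.2 _ (Icc_subset_setOf_coe_lt hd ⟨zero_le, hu.le⟩)) h₀ ⟨zero_le, le_rfl⟩

theorem IsLipschitzArc.condE1 {v : M → ℝ} {K : ℝ} (hX : IsLipschitzArc X v K) : CondE1 X :=
  fun _ => ⟨1, one_pos, 1, one_pos, K, fun f _ g _ t _ _ => by
    rw [mul_comm (t : ℝ)]; exact hX.spread t f g⟩

/-- If the flow of a globally controlled arc field `X'` stays in an open set where `X' = X`, then
the Euler scheme of `X` converges to that flow. -/
theorem IsLipschitzArc.tendsto_euler_of_eqOn [CompleteSpace M] {X' : ℝ≥0 → M → M} {v : M → ℝ}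
    {K : ℝ} (hX' : IsLipschitzArc X' v K) {U : Set M} (hU : IsOpen U)
    (heq : ∀ f ∈ U, ∀ t, X t f = X' t f) {f : M} {t : ℝ≥0}
    (hf : ∀ u ∈ Set.Icc 0 t, hX'.flow u f ∈ U) :
    Tendsto (fun n : ℕ => (X (t / n))^[n] f) atTop (𝓝 (hX'.flow t f)) := by
  have hK := hX'.K_nonneg
  have hv := hX'.v_nonneg f
  obtain ⟨δ, hδ, hδU⟩ := ((isCompact_Icc (a := (0 : ℝ≥0)) (b := t)).image
    (hX'.continuous_flow_time f)).exists_thickening_subset_open hU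
      (by rintro _ ⟨u, hu, rfl⟩; exact hf u hu)
  -- This bounds the distance from every Euler point of `X'` to the flow at the same grid time, so
  -- for large `n` these points lie in the `δ`-thickening of the trace, hence in `U`.
  have hlim := (tendsto_const_div_atTop_nhds_zero_nat (K * t * t * Real.exp (K * t) * v f))
  refine (hX'.tendsto_flow t f).congr' ?_
  filter_upwards [hlim.eventually (gt_mem_nhds hδ), eventually_ne_atTop 0] with n hn hn0
  have hn0' : (0 : ℝ) < n := by exact_mod_cast Nat.pos_of_ne_zero hn0
  refine (iterate_eq_of_forall_mem heq fun k hk => hδU ?_).symm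
  have hkn : (k : ℝ) * ((t / n : ℝ≥0) : ℝ) ≤ t := by
    push_cast
    rw [← mul_div_assoc, div_le_iff₀ hn0', mul_comm]
    have : (k : ℝ) ≤ n := by exact_mod_cast hk.le
    gcongr
  refine Metric.mem_thickening_iff.2 ⟨_, ⟨k * (t / n), ⟨zero_le, by exact_mod_cast hkn⟩, rfl⟩, ?_⟩
  refine (hX'.dist_iterate_flow _ _ _).trans_lt (lt_of_le_of_lt ?_ hn)
  calc _ ≤ K * t * ((t / n : ℝ≥0) : ℝ) * Real.exp (K * t) * v f := by gcongr
    _ = _ := by push_cast; ring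

/-- Near a forward tangent curve on `[0, t]` there is a continuous local flow, defined for a time
larger than `t`, to which the Euler scheme converges. -/
theorem IsLocallyLipschitzArc.exists_flow_near [CompleteSpace M] (hX : IsLocallyLipschitzArc X)
    {σ : ℝ≥0 → M} {t : ℝ≥0} (hσ : ContinuousOn σ (Set.Icc 0 t))
    (hσX : ∀ u < t, ForwardTangentAt X σ u) :
    ∃ c > t, ∃ N ∈ 𝓝 (σ 0), ∃ G : ℝ≥0 → M → M, Continuous (fun p : M × ℝ≥0 => G p.2 p.1) ∧
      (∀ g ∈ N, G 0 g = g ∧ IsSolution X (fun u => G u g) c) ∧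
      Tendsto (fun n : ℕ => (X (t / n))^[n] (σ 0)) atTop (𝓝 (G t (σ 0))) := by
  obtain ⟨X', v, K, hX', U, hU, hCU, heq⟩ := hX (Set.image σ (Set.Icc 0 t))
    (isCompact_Icc.image_of_continuousOn hσ)
  -- Along `σ` the two fields agree, so `σ` is tangent to `X'` as well, and uniqueness for `X'`
  -- identifies it with the flow.
  have hσG : Set.EqOn (fun u => hX'.flow u (σ 0)) σ (Set.Icc 0 t) :=
    eqOn_of_tangent hX'.condE1 (hX'.continuous_flow_time _).continuousOn hσ
      (fun u _ => hX'.flow_tangent _ u)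
      (fun u hu => (hσX u hu).congr_field (heq _ (hCU ⟨u, ⟨zero_le, hu.le⟩, rfl⟩)))
      (hX'.flow_zero _)
  have hGU : ∀ u ∈ Set.Icc 0 t, hX'.flow u (σ 0) ∈ U := fun u hu => by
    rw [show hX'.flow u (σ 0) = σ u from hσG hu]
    exact hCU ⟨u, hu, rfl⟩
  -- Compactness of `[0, t]` keeps the flow in `U` uniformly for initial points in `N`; openness of
  -- `W` at `t` gives the extra time up to `c`.
  obtain ⟨N, W, hN, hW, hfN, htW, hNW⟩ := generalized_tube_lemma (isCompact_singleton (x := σ 0))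
    (isCompact_Icc (a := (0 : ℝ≥0)) (b := t)) (hU.preimage hX'.continuous_flow)
    (by rintro ⟨g, u⟩ ⟨rfl, hu⟩; exact hGU u hu)
  obtain ⟨c, hc, hcW⟩ := mem_nhdsGE_iff_exists_Ico_subset.1
    (nhdsWithin_le_nhds (s := Set.Ici t) (hW.mem_nhds (htW ⟨zero_le, le_rfl⟩)))
  refine ⟨c, hc, N, hN.mem_nhds (hfN rfl), hX'.flow, hX'.continuous_flow, fun g hg =>
    ⟨hX'.flow_zero g, (hX'.continuous_flow_time g).continuousOn, fun u hu => ?_⟩,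
    hX'.tendsto_euler_of_eqOn hU heq hGU⟩
  have huc : u < c := by exact_mod_cast hu
  have huW : u ∈ W := by
    rcases le_total u t with h | h
    · exact htW ⟨zero_le, h⟩
    · exact hcW ⟨h, huc⟩
  exact (hX'.flow_tangent g u).congr_field fun s => (heq _ (hNW (Set.mk_mem_prod hg huW)) s).symm

/-! ### The maximal local flow. -/

/-- The supremum of the times up to which a forward tangent curve from `f` exists. -/
noncomputable def lifetime (X : ℝ≥0 → M → M) (f : M) : ℝ≥0∞ :=
  sSup {c | ∃ σ : ℝ≥0 → M, σ 0 = f ∧ IsSolution X σ c}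

open Classical in
/-- The maximal local flow, obtained by following forward tangent curves. -/
noncomputable def maxFlow (X : ℝ≥0 → M → M) (t : ℝ≥0) (f : M) : M :=
  if h : ∃ σ : ℝ≥0 → M, σ 0 = f ∧ ∃ c : ℝ≥0∞, (t : ℝ≥0∞) < c ∧ IsSolution X σ c then h.choose t
  else f

theorem IsSolution.le_lifetime {σ : ℝ≥0 → M} {c : ℝ≥0∞} (h : IsSolution X σ c) :
    c ≤ lifetime X (σ 0) := le_sSup ⟨σ, rfl, h⟩

theorem exists_of_lt_lifetime {f : M} {t : ℝ≥0} (h : (t : ℝ≥0∞) < lifetime X f) :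
    ∃ σ : ℝ≥0 → M, σ 0 = f ∧ ∃ c : ℝ≥0∞, (t : ℝ≥0∞) < c ∧ IsSolution X σ c := by
  obtain ⟨c, ⟨σ, h0, hσ⟩, hc⟩ := lt_sSup_iff.1 h
  exact ⟨σ, h0, c, hc, hσ⟩

theorem maxFlow_zero (f : M) : maxFlow X 0 f = f := by
  unfold maxFlow
  split_ifs with h
  · exact h.choose_spec.1
  · rfl

theorem IsSolution.maxFlow_eq (hE : CondE1 X) {σ : ℝ≥0 → M} {c : ℝ≥0∞} (hσ : IsSolution X σ c)
    {t : ℝ≥0} (ht : (t : ℝ≥0∞) < c) : maxFlow X t (σ 0) = σ t := by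
  have h : ∃ τ : ℝ≥0 → M, τ 0 = σ 0 ∧ ∃ c : ℝ≥0∞, (t : ℝ≥0∞) < c ∧ IsSolution X τ c :=
    ⟨σ, rfl, c, ht, hσ⟩
  unfold maxFlow
  rw [dif_pos h]
  obtain ⟨h0, d, hd, hsol⟩ := h.choose_spec
  exact hsol.eq hE hσ h0 hd ht

/-- `maxFlow` may choose a different curve at each time, but by uniqueness it coincides near a given
time with a single solution. -/
theorem isSolution_maxFlow (hE : CondE1 X) (f : M) :
    IsSolution X (fun u => maxFlow X u f) (lifetime X f) := by
  have key : ∀ t : ℝ≥0, (t : ℝ≥0∞) < lifetime X f →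
      ContinuousAt (fun u => maxFlow X u f) t ∧ ForwardTangentAt X (fun u => maxFlow X u f) t := by
    intro t ht
    obtain ⟨σ, rfl, c, hc, hσ⟩ := exists_of_lt_lifetime ht
    have hev : σ =ᶠ[𝓝 t] fun u => maxFlow X u (σ 0) := by
      filter_upwards [(isOpen_setOf_coe_lt c).mem_nhds hc] with u hu
      exact (hσ.maxFlow_eq hE hu).symm
    exact ⟨(hσ.1.continuousAt ((isOpen_setOf_coe_lt c).mem_nhds hc)).congr hev,
      (hσ.2 t hc).congr_curve hev⟩
  exact ⟨fun t ht => (key t ht).1.continuousWithinAt, fun t ht => (key t ht).2⟩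

theorem IsLocallyLipschitzArc.exists_flow_near_of_lt [CompleteSpace M]
    (hX : IsLocallyLipschitzArc X) {f : M} {t : ℝ≥0} (ht : (t : ℝ≥0∞) < lifetime X f) :
    ∃ c > t, ∃ N ∈ 𝓝 f, ∃ G : ℝ≥0 → M → M, Continuous (fun p : M × ℝ≥0 => G p.2 p.1) ∧
      (∀ g ∈ N, (c : ℝ≥0∞) ≤ lifetime X g ∧ ∀ u < c, G u g = maxFlow X u g) ∧
      Tendsto (fun n : ℕ => (X (t / n))^[n] f) atTop (𝓝 (maxFlow X t f)) := by
  have hE := hX.condE1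
  have hsol := isSolution_maxFlow hE f
  obtain ⟨c, hc, N, hN, G, hG, hNG, hlim⟩ := hX.exists_flow_near
    (hsol.1.mono (Icc_subset_setOf_coe_lt ht))
    (fun u hu => hsol.2 u (Icc_subset_setOf_coe_lt ht ⟨zero_le, hu.le⟩))
  rw [maxFlow_zero] at hN hlim
  have hGm : ∀ g ∈ N, (c : ℝ≥0∞) ≤ lifetime X g ∧ ∀ u < c, G u g = maxFlow X u g := by
    intro g hg
    obtain ⟨h0, hs⟩ := hNG g hg
    have h1 := hs.le_lifetime
    have h2 := fun (u : ℝ≥0) (hu : u < c) =>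
      hs.maxFlow_eq hE (t := u) (by exact_mod_cast hu)
    simp only [h0] at h1 h2
    exact ⟨h1, fun u hu => (h2 u hu).symm⟩
  refine ⟨c, hc, N, hN, G, hG, hGm, ?_⟩
  rwa [← (hGm f (mem_of_mem_nhds hN)).2 t hc]

theorem IsLocallyLipschitzArc.isLocalFlowOf [CompleteSpace M] (hX : IsLocallyLipschitzArc X) :
    IsLocalFlowOf X (lifetime X) (maxFlow X) := by
  have hE := hX.condE1
  have hnear : ∀ p : M × ℝ≥0, (p.2 : ℝ≥0∞) < lifetime X p.1 →
      (∀ᶠ q : M × ℝ≥0 in 𝓝 p, (q.2 : ℝ≥0∞) < lifetime X q.1) ∧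
      ContinuousAt (fun q : M × ℝ≥0 => maxFlow X q.2 q.1) p := by
    intro p hp
    obtain ⟨c, hc, N, hN, G, hG, hGm, -⟩ := hX.exists_flow_near_of_lt hp
    have hev : ∀ᶠ q : M × ℝ≥0 in 𝓝 p, q.1 ∈ N ∧ q.2 < c :=
      (continuous_fst.continuousAt.eventually hN).and
        (continuous_snd.continuousAt.eventually (gt_mem_nhds hc))
    refine ⟨hev.mono fun q hq => lt_of_lt_of_le (by exact_mod_cast hq.2) (hGm _ hq.1).1,
      hG.continuousAt.congr (hev.mono fun q hq => (hGm _ hq.1).2 _ hq.2)⟩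
  refine ⟨fun f => ?_, ?_, ?_, maxFlow_zero, ?_, fun f => (isSolution_maxFlow hE f).2⟩
  -- Local existence is the case `t = 0`, where tangency on `[0, 0)` is vacuous.
  · obtain ⟨c, hc, N, hN, G, -, hNG, -⟩ := hX.exists_flow_near (σ := fun _ => f) (t := 0)
      continuousOn_const (fun u hu => absurd hu not_lt_zero)
    obtain ⟨h0, hs⟩ := hNG f (mem_of_mem_nhds hN)
    have h1 := hs.le_lifetime
    simp only [h0] at h1
    exact lt_of_lt_of_le (by exact_mod_cast hc) h1
  · exact isOpen_iff_eventually.2 fun p hp => (hnear p hp).1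
  · exact fun p hp => (hnear p hp).2.continuousWithinAt
  · intro f s t hs ht hst
    have h1 := isSolution_maxFlow hE f
    -- The time-shifted curve is a solution from `maxFlow X s f`, so uniqueness gives the flow
    -- identity.
    have h2 : IsSolution X (fun u => maxFlow X (s + u) f) (lifetime X f - s) := by
      have hmem : ∀ u : ℝ≥0, (u : ℝ≥0∞) < lifetime X f - s →
          ((s + u : ℝ≥0) : ℝ≥0∞) < lifetime X f := by
        intro u hu
        rw [ENNReal.coe_add, add_comm]
        exact lt_tsub_iff_right.1 hu
      exact ⟨h1.1.comp (by fun_prop) hmem, fun u hu => (h1.2 _ (hmem u hu)).shift⟩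
    have h3 : (t : ℝ≥0∞) < lifetime X f - s := by
      rw [lt_tsub_iff_right, add_comm]
      exact_mod_cast hst
    simpa using h2.maxFlow_eq hE h3

theorem IsLocalFlowOf.isSolution {T : M → ℝ≥0∞} {F : ℝ≥0 → M → M} (h : IsLocalFlowOf X T F)
    (f : M) : IsSolution X (fun u => F u f) (T f) := by
  refine ⟨?_, h.tangent f⟩
  exact h.continuousOn.comp (f := fun u : ℝ≥0 => (f, u)) (by fun_prop) fun _ ht => ht

theorem IsLocalFlowOf.le_lifetime {T : M → ℝ≥0∞} {F : ℝ≥0 → M → M} (h : IsLocalFlowOf X T F)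
    (f : M) : T f ≤ lifetime X f := by
  simpa [h.zero] using (h.isSolution f).le_lifetime

theorem IsLocalFlowOf.eq_maxFlow (hE : CondE1 X) {T : M → ℝ≥0∞} {F : ℝ≥0 → M → M}
    (h : IsLocalFlowOf X T F) {f : M} {t : ℝ≥0} (ht : (t : ℝ≥0∞) < T f) :
    F t f = maxFlow X t f := by
  simpa [h.zero] using ((h.isSolution f).maxFlow_eq hE ht).symm

/-- Through this, maximality yields both infinite lifetime and uniqueness of global flows. -/
theorem IsFlowOf.isLocalFlowOf {F : ℝ≥0 → M → M} (h : IsFlowOf X F) :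
    IsLocalFlowOf X (fun _ => ∞) F where
  pos _ := ENNReal.zero_lt_top
  isOpen_domain := by simp
  continuousOn := h.continuous.continuousOn
  zero := h.zero
  add f s t _ _ _ := h.add f s t
  tangent f t _ := h.tangent f t

theorem IsFlowOf.eq_maxFlow (hE : CondE1 X) {F : ℝ≥0 → M → M} (h : IsFlowOf X F) :
    F = maxFlow X :=
  funext fun _ => funext fun _ => h.isLocalFlowOf.eq_maxFlow hE ENNReal.coe_lt_top

end LocalTheory

/-! ### Clipping of real numbers at extended real bounds. -/

section ClipLemmas

theorem clip_of_mem {lo hi : EReal} (h : lo < hi) {y : ℝ} (h₁ : lo ≤ y) (h₂ : (y : EReal) ≤ hi) :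
    clip lo hi y = y := by
  have := coe_clip h y
  rw [max_eq_right h₁, min_eq_left h₂] at this
  exact_mod_cast this

theorem coe_clip_of_le {lo hi : EReal} (h : lo < hi) {y : ℝ} (h₁ : (y : EReal) ≤ lo) :
    (clip lo hi y : EReal) = lo := by
  rw [coe_clip h, max_eq_left h₁, min_eq_left h.le]

theorem coe_clip_of_ge {lo hi : EReal} (h : lo < hi) {y : ℝ} (h₂ : hi ≤ (y : EReal)) :
    (clip lo hi y : EReal) = hi := by
  rw [coe_clip h, min_eq_right (h₂.trans (le_max_right _ _))]

theorem clip_mono {lo hi : EReal} (h : lo < hi) : Monotone (clip lo hi) := by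
  intro x y hxy
  have : (x : EReal) ≤ y := by exact_mod_cast hxy
  rw [← EReal.coe_le_coe_iff, coe_clip h, coe_clip h]
  exact min_le_min_right _ (max_le_max_left _ this)

/-- Either both points are clipped to the same barrier, or clipping does not raise `y` and does not
lower `x`. -/
theorem clip_sub_clip_le {lo hi : EReal} (h : lo < hi) {x y : ℝ} (hxy : x ≤ y) :
    clip lo hi y - clip lo hi x ≤ y - x := by
  rcases le_total (y : EReal) lo with hy | hy
  · have h1 := coe_clip_of_le h hy
    have h2 := coe_clip_of_le h ((EReal.coe_le_coe_iff.2 hxy).trans hy)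
    have h3 := EReal.coe_eq_coe_iff.1 (h1.trans h2.symm)
    linarith
  rcases le_total hi (x : EReal) with hx | hx
  · have h1 := coe_clip_of_ge h hx
    have h2 := coe_clip_of_ge h (hx.trans (EReal.coe_le_coe_iff.2 hxy))
    have h3 := EReal.coe_eq_coe_iff.1 (h1.trans h2.symm)
    linarith
  have h1 : clip lo hi y ≤ y := by
    rw [← EReal.coe_le_coe_iff, coe_clip h, max_eq_right hy]
    exact min_le_left _ _
  have h2 : x ≤ clip lo hi x := by
    rw [← EReal.coe_le_coe_iff, coe_clip h]
    exact le_min (le_max_right _ _) hx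
  linarith

theorem abs_clip_sub_clip_le {lo hi : EReal} (h : lo < hi) (x y : ℝ) :
    |clip lo hi x - clip lo hi y| ≤ |x - y| := by
  rcases le_total x y with hxy | hxy
  · rw [abs_sub_comm, abs_sub_comm x, abs_of_nonneg (sub_nonneg.2 (clip_mono h hxy)),
      abs_of_nonneg (sub_nonneg.2 hxy)]
    exact clip_sub_clip_le h hxy
  · rw [abs_of_nonneg (sub_nonneg.2 (clip_mono h hxy)), abs_of_nonneg (sub_nonneg.2 hxy)]
    exact clip_sub_clip_le h hxy

/-- Clipping twice along a segment in a fixed direction is the same as clipping once. -/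
theorem clip_clip_add {lo hi : EReal} (h : lo < hi) {y : ℝ} (h₁ : lo ≤ y) (h₂ : (y : EReal) ≤ hi)
    (w : ℝ) (s t : ℝ≥0) :
    clip lo hi (clip lo hi (y + s * w) + t * w) = clip lo hi (y + (s + t) * w) := by
  rcases le_total ((y + s * w : ℝ) : EReal) lo with hl | hl
  -- Moving upward from `y ≥ lo`, the point can be at or below `lo` only by being equal to it, so
  -- the first clip is inert. Moving downward, both sides stay clipped at `lo`. The upper barrier is
  -- symmetric.
  · rcases le_or_gt 0 w with hw | hw
    · have e : ((y + s * w : ℝ) : EReal) = lo :=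
        le_antisymm hl (h₁.trans (EReal.coe_le_coe_iff.2 (by nlinarith [s.coe_nonneg])))
      rw [clip_of_mem h e.ge (e.le.trans h.le)]
      ring_nf
    · have e := coe_clip_of_le h hl
      rw [← EReal.coe_eq_coe_iff, coe_clip_of_le h, coe_clip_of_le h]
      · refine le_trans (EReal.coe_le_coe_iff.2 ?_) hl
        nlinarith [t.coe_nonneg]
      · refine le_trans (EReal.coe_le_coe_iff.2 ?_) e.le
        nlinarith [t.coe_nonneg]
  rcases le_total hi ((y + s * w : ℝ) : EReal) with hu | hu
  · rcases le_or_gt w 0 with hw | hw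
    · have e : ((y + s * w : ℝ) : EReal) = hi :=
        le_antisymm ((EReal.coe_le_coe_iff.2 (by nlinarith [s.coe_nonneg])).trans h₂) hu
      rw [clip_of_mem h (h.le.trans e.ge) e.le]
      ring_nf
    · have e := coe_clip_of_ge h hu
      rw [← EReal.coe_eq_coe_iff, coe_clip_of_ge h, coe_clip_of_ge h]
      · refine le_trans hu (EReal.coe_le_coe_iff.2 ?_)
        nlinarith [t.coe_nonneg]
      · refine le_trans e.ge (EReal.coe_le_coe_iff.2 ?_)
        nlinarith [t.coe_nonneg]
  rw [clip_of_mem h hl hu]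
  ring_nf

end ClipLemmas

/-! ### Locally Lipschitz maps near compact sets, and cutoffs. -/

section Cutoff

/-- A locally Lipschitz map is Lipschitz on some neighborhood of each compact set. -/
theorem exists_lipschitzOnWith_isOpen_of_isCompact {M E : Type*} [MetricSpace M]
    [MetricSpace E] {V : M → E} (hV : LocallyLipschitz V) {C : Set M} (hC : IsCompact C) :
    ∃ (K : ℝ≥0) (U : Set M), IsOpen U ∧ C ⊆ U ∧ LipschitzOnWith K V U := by
  -- Compactness is applied to pairs, because Lipschitz bounds on two sets do not control pairs with
  -- one point in each. Near the diagonal the local constant serves; off it, the difference quotient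
  -- is continuous.
  let P : Set (M × M) → Prop := fun s => ∃ (K : ℝ≥0) (W : Set (M × M)), IsOpen W ∧ s ⊆ W ∧
    ∀ p ∈ W, dist (V p.1) (V p.2) ≤ K * dist p.1 p.2
  have hP : P (C ×ˢ C) := by
    refine (hC.prod hC).induction_on ⟨0, ∅, isOpen_empty, subset_rfl, by simp⟩ ?_ ?_ ?_
    · rintro s t hst ⟨K, W, hW, htW, h⟩
      exact ⟨K, W, hW, hst.trans htW, h⟩
    · rintro s t ⟨K, W, hW, hsW, h⟩ ⟨K', W', hW', htW', h'⟩
      refine ⟨max K K', W ∪ W', hW.union hW', Set.union_subset_union hsW htW', ?_⟩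
      rintro p (hp | hp)
      · refine (h p hp).trans ?_
        gcongr
        exact le_max_left _ _
      · refine (h' p hp).trans ?_
        gcongr
        exact le_max_right _ _
    · rintro ⟨x, y⟩ -
      suffices ∃ K : ℝ≥0, ∀ᶠ p : M × M in 𝓝 (x, y), dist (V p.1) (V p.2) ≤ K * dist p.1 p.2 by
        obtain ⟨K, hK⟩ := this
        obtain ⟨W, hWs, hW, hxy⟩ := mem_nhds_iff.1 hK
        exact ⟨W, mem_nhdsWithin_of_mem_nhds (hW.mem_nhds hxy), K, W, hW, subset_rfl, hWs⟩
      rcases eq_or_ne x y with rfl | hne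
      · obtain ⟨K, t, ht, hK⟩ := hV x
        refine ⟨K, ?_⟩
        rw [nhds_prod_eq]
        filter_upwards [prod_mem_prod ht ht] with p hp
        exact hK.dist_le_mul _ hp.1 _ hp.2
      · have hd : 0 < dist x y := dist_pos.2 hne
        have hc : ContinuousAt (fun p : M × M => dist (V p.1) (V p.2) / dist p.1 p.2) (x, y) := by
          have := hV.continuous
          exact ContinuousAt.div (by fun_prop) (by fun_prop) hd.ne'
        have h1 := hc.eventually (gt_mem_nhds (lt_add_one _))
        have h2 : ∀ᶠ p : M × M in 𝓝 (x, y), 0 < dist p.1 p.2 :=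
          continuous_dist.continuousAt.eventually (lt_mem_nhds hd)
        refine ⟨(dist (V x) (V y) / dist x y + 1).toNNReal, ?_⟩
        filter_upwards [h1, h2] with p hp1 hp2
        rw [Real.coe_toNNReal _ (by positivity), ← div_le_iff₀ hp2]
        exact hp1.le
  obtain ⟨K, W, hW, hCW, h⟩ := hP
  obtain ⟨u, v, hu, hv, hCu, hCv, huv⟩ := generalized_tube_lemma hC hC hW hCW
  refine ⟨K, u ∩ v, hu.inter hv, Set.subset_inter hCu hCv,
    LipschitzOnWith.of_dist_le_mul fun x hx y hy => h (x, y) (huv ⟨hx.1, hy.2⟩)⟩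

/-- A locally Lipschitz map into a normed space agrees near each compact set with a globally
Lipschitz map. -/
theorem exists_lipschitzWith_eqOn_of_isCompact {M E : Type*} [MetricSpace M]
    [NormedAddCommGroup E] [NormedSpace ℝ E] {V : M → E} (hV : LocallyLipschitz V) {C : Set M}
    (hC : IsCompact C) :
    ∃ (K : ℝ≥0) (V' : M → E), LipschitzWith K V' ∧
      ∃ U : Set M, IsOpen U ∧ C ⊆ U ∧ Set.EqOn V V' U := by
  obtain ⟨L, U, hU, hCU, hL⟩ := exists_lipschitzOnWith_isOpen_of_isCompact hV hC
  rcases C.eq_empty_or_nonempty with rfl | hne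
  · exact ⟨0, fun _ => 0, LipschitzWith.const 0, ∅, isOpen_empty, subset_rfl, by simp⟩
  obtain ⟨δ, hδ, hδU⟩ := hC.exists_thickening_subset_open hU hCU
  obtain ⟨B, hB⟩ := hC.exists_bound_of_continuousOn hV.continuous.continuousOn
  have hB0 : 0 ≤ B := (norm_nonneg _).trans (hB _ hne.some_mem)
  set D : M → ℝ := fun f => Metric.infDist f C with hD
  have hDlip : ∀ f g, |D f - D g| ≤ dist f g := fun f g => by
    simpa [Real.dist_eq] using (Metric.lipschitz_infDist_pt C).dist_le_mul f g
  have hDU : ∀ f, D f < δ → f ∈ U := fun f hf =>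
    hδU ((Metric.mem_thickening_iff_infDist_lt hne).2 hf)
  -- Piecewise linear cutoff: 1 up to `δ / 2`, 0 from `δ` on, slope `-2 / δ` between.
  set χ : ℝ → ℝ := fun d => max 0 (min 1 (2 - 2 / δ * d)) with hχ
  have hχ0 : ∀ d, 0 ≤ χ d := fun d => le_max_left _ _
  have hχ1 : ∀ d, χ d ≤ 1 := fun d => max_le zero_le_one (min_le_left _ _)
  have hχδ : ∀ d, δ ≤ d → χ d = 0 := fun d hd => by
    refine max_eq_left ((min_le_right _ _).trans ?_)
    have : 2 ≤ 2 / δ * d := by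
      rw [div_mul_eq_mul_div, le_div_iff₀ hδ]
      linarith
    linarith
  have hχone : ∀ d, d < δ / 2 → χ d = 1 := fun d hd => by
    have : 2 / δ * d ≤ 1 := by
      rw [div_mul_eq_mul_div, div_le_iff₀ hδ]
      linarith
    simp only [hχ]
    rw [min_eq_left (by linarith), max_eq_right zero_le_one]
  have hχlip : ∀ f g, |χ (D f) - χ (D g)| ≤ 2 / δ * dist f g := fun f g => by
    calc |χ (D f) - χ (D g)| ≤ |(2 - 2 / δ * D f) - (2 - 2 / δ * D g)| :=
          (abs_max_sub_max_le_max _ _ _ _).trans (by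
            rw [sub_self, abs_zero, max_eq_right (abs_nonneg _)]
            refine (abs_min_sub_min_le_max _ _ _ _).trans ?_
            rw [sub_self, abs_zero, max_eq_right (abs_nonneg _)])
      _ = 2 / δ * |D f - D g| := by
        rw [← abs_of_pos (show 0 < 2 / δ by positivity), ← abs_mul, abs_sub_comm,
          abs_of_pos (show 0 < 2 / δ by positivity)]
        ring_nf
      _ ≤ _ := by gcongr; exact hDlip f g
  have hbd : ∀ f, D f < δ → ‖V f‖ ≤ B + L * δ := fun f hf => by
    obtain ⟨c, hc, hfc⟩ := (Metric.infDist_lt_iff hne).1 hf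
    have h1 := hL.dist_le_mul f (hDU f hf) c (hCU hc)
    rw [dist_eq_norm] at h1
    have h2 : ‖V f‖ ≤ ‖V f - V c‖ + ‖V c‖ := by simpa using norm_add_le (V f - V c) (V c)
    have h3 : L * dist f c ≤ L * δ := by gcongr
    linarith [hB c hc]
  -- Ordering by distance to `C` ensures that if `g` is outside the thickening then both values
  -- vanish. Otherwise `L` accounts for the change of `V`, and `2 / δ * (B + L * δ)` for the change
  -- of `χ` times the bound on `V g`.
  have hmain : ∀ f g, D g ≤ D f → dist (χ (D f) • V f) (χ (D g) • V g) ≤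
      (L + 2 / δ * (B + L * δ)) * dist f g := by
    intro f g hgf
    rcases lt_or_ge (D g) δ with hg | hg
    · have h2 : |χ (D f) - χ (D g)| * ‖V g‖ ≤ 2 / δ * dist f g * (B + L * δ) := by
        have := hbd g hg
        have := hχlip f g
        gcongr
      have h1 : χ (D f) * ‖V f - V g‖ ≤ L * dist f g := by
        rcases lt_or_ge (D f) δ with hf | hf
        · rw [← dist_eq_norm]
          calc _ ≤ 1 * dist (V f) (V g) := by gcongr; exact hχ1 _
            _ ≤ _ := by rw [one_mul]; exact hL.dist_le_mul f (hDU f hf) g (hDU g hg)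
        · rw [hχδ _ hf, zero_mul]
          positivity
      have e : χ (D f) • V f - χ (D g) • V g =
          χ (D f) • (V f - V g) + (χ (D f) - χ (D g)) • V g := by
        rw [smul_sub, sub_smul]; abel
      rw [dist_eq_norm, e]
      refine (norm_add_le _ _).trans ?_
      rw [norm_smul, norm_smul, Real.norm_eq_abs, Real.norm_eq_abs, abs_of_nonneg (hχ0 _)]
      linarith
    · rw [hχδ _ hg, hχδ _ (hg.trans hgf)]
      simp only [zero_smul, dist_self]
      positivity
  refine ⟨(L + 2 / δ * (B + L * δ)).toNNReal, fun f => χ (D f) • V f,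
    LipschitzWith.of_dist_le_mul fun f g => ?_, {f | D f < δ / 2},
    isOpen_lt (Metric.continuous_infDist_pt C) continuous_const, fun f hf => ?_, fun f hf => ?_⟩
  · rw [Real.coe_toNNReal _ (by positivity)]
    rcases le_total (D g) (D f) with h | h
    · exact hmain f g h
    · rw [dist_comm, dist_comm f]
      exact hmain g f h
  · simp only [Set.mem_ofPred_eq, hD, Metric.infDist_zero_of_mem hf]
    positivity
  · simp only [hχone _ hf, one_smul]

end Cutoff

/-! ### The clipped arc field on the complete space `Between a b`. -/

section ClipArc

variable {S : Type*} [MeasurableSpace S] {a b : S → EReal}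

theorem norm_apply_le (f : BddMeas S) (x : S) : |f.1 x| ≤ ‖f‖ :=
  lp.norm_apply_le_norm ENNReal.top_ne_zero f.1 x

theorem abs_apply_sub_le (f g : BddMeas S) (x : S) : |f.1 x - g.1 x| ≤ dist f g := by
  rw [dist_eq_norm]
  exact norm_apply_le (f - g) x

theorem dist_between_le {f g : Between a b} {c : ℝ} (hc : 0 ≤ c)
    (h : ∀ x, |f.1.1 x - g.1.1 x| ≤ c) : dist f g ≤ c := by
  rw [Subtype.dist_eq, dist_eq_norm]
  exact lp.norm_le_of_forall_le (f := (f.1 - g.1).1) hc h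

theorem continuous_bddMeas_apply (x : S) : Continuous fun f : BddMeas S => f.1 x :=
  LipschitzWith.continuous (K := 1) <| LipschitzWith.of_dist_le_mul fun f g => by
    simpa [Real.dist_eq] using abs_apply_sub_le f g x

instance completeSpace_bddMeas : CompleteSpace (BddMeas S) := by
  refine IsClosed.completeSpace_coe
    (s := ((BddMeas S : Submodule ℝ _) : Set (lp (fun _ : S => ℝ) ∞))) (hs := ?_)
  refine IsSeqClosed.isClosed fun u f hu huf => ?_
  refine measurable_of_tendsto_metrizable (f := fun n x => u n x) hu ?_
  refine tendsto_pi_nhds.2 fun x => ?_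
  refine tendsto_iff_dist_tendsto_zero.2 (squeeze_zero (fun _ => dist_nonneg) (fun n => ?_)
    (tendsto_iff_dist_tendsto_zero.1 huf))
  rw [dist_eq_norm, dist_eq_norm]
  exact lp.norm_apply_le_norm ENNReal.top_ne_zero (u n - f) x

instance completeSpace_between : CompleteSpace (Between a b) := by
  refine IsClosed.completeSpace_coe (hs := ?_)
  have : Between a b = ⋂ x, {f : BddMeas S | a x ≤ ((f.1 x : ℝ) : EReal) ∧
      ((f.1 x : ℝ) : EReal) ≤ b x} := by
    ext f; simp [Between]
  rw [this]
  refine isClosed_iInter fun x => ?_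
  have hc : Continuous fun f : BddMeas S => ((f.1 x : ℝ) : EReal) :=
    continuous_coe_real_ereal.comp (continuous_bddMeas_apply x)
  exact (isClosed_le continuous_const hc).inter (isClosed_le hc continuous_const)

theorem isLipschitzArc_clipArc (ha : Measurable a) (hb : Measurable b)
    (hab : 0 < ⨅ x, (b x - a x)) {V : Between a b → BddMeas S} {K : ℝ≥0}
    (hV : LipschitzWith K V) :
    IsLipschitzArc (clipArc a b ha hb hab V) (fun f => ‖V f‖) K := by
  have hlt : ∀ x, a x < b x := fun x => lt_of_sub_pos (lt_of_lt_of_le hab (iInf_le _ x))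
  have hval : ∀ (t : ℝ≥0) (f : Between a b) (x : S), (clipArc a b ha hb hab V t f).1.1 x =
      clip (a x) (b x) (f.1.1 x + t * (V f).1 x) := fun _ _ _ => rfl
  have hzero : ∀ f, clipArc a b ha hb hab V 0 f = f := by
    intro f
    refine dist_le_zero.1 (dist_between_le le_rfl fun x => ?_)
    rw [hval, NNReal.coe_zero, zero_mul, add_zero, clip_of_mem (hlt x) (f.2 x).1 (f.2 x).2]
    simp
  have hspeed : ∀ (s t : ℝ≥0) f,
      dist (clipArc a b ha hb hab V s f) (clipArc a b ha hb hab V t f) ≤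
      |(s : ℝ) - t| * ‖V f‖ := by
    intro s t f
    refine dist_between_le (by positivity) fun x => ?_
    rw [hval, hval]
    refine (abs_clip_sub_clip_le (hlt x) _ _).trans ?_
    have e : f.1.1 x + s * (V f).1 x - (f.1.1 x + t * (V f).1 x) = (s - t) * (V f).1 x := by ring
    rw [e, abs_mul]
    gcongr
    exact norm_apply_le _ _
  have hself : ∀ (t : ℝ≥0) f, dist (clipArc a b ha hb hab V t f) f ≤ t * ‖V f‖ := by
    intro t f
    simpa [hzero] using hspeed t 0 f
  refine ⟨K.coe_nonneg, fun _ => norm_nonneg _, hV.continuous.norm, hzero, ?_, hspeed, ?_, ?_⟩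
  · intro t f g
    refine dist_between_le (by positivity) fun x => ?_
    rw [hval, hval]
    refine (abs_clip_sub_clip_le (hlt x) _ _).trans ?_
    have e : f.1.1 x + t * (V f).1 x - (g.1.1 x + t * (V g).1 x) =
      (f.1.1 x - g.1.1 x) + t * ((V f).1 x - (V g).1 x) := by ring
    have h1 : |f.1.1 x - g.1.1 x| ≤ dist f g := abs_apply_sub_le f.1 g.1 x
    have h2 : |(V f).1 x - (V g).1 x| ≤ K * dist f g :=
      (abs_apply_sub_le _ _ x).trans (hV.dist_le_mul f g)
    rw [e]
    refine (abs_add_le _ _).trans ?_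
    rw [abs_mul, NNReal.abs_eq]
    calc _ ≤ dist f g + t * (K * dist f g) := by gcongr
      _ = _ := by ring
  · intro s t f
    refine dist_between_le (by positivity) fun x => ?_
    -- Writing the long step as two clipped steps in the frozen direction `V f` leaves only `t`
    -- times the difference of `V` at `f` and at the point reached after time `s`.
    rw [hval, hval t, hval, NNReal.coe_add, ← clip_clip_add (hlt x) (f.2 x).1 (f.2 x).2]
    refine (abs_clip_sub_clip_le (hlt x) _ _).trans ?_
    have h1 := (abs_apply_sub_le (V f) (V (clipArc a b ha hb hab V s f)) x).trans
      (hV.dist_le_mul _ _)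
    have h2 := hself s f
    rw [dist_comm] at h2
    rw [add_sub_add_left_eq_sub, ← mul_sub, abs_mul, NNReal.abs_eq]
    calc _ ≤ t * (K * (s * ‖V f‖)) := by
          refine mul_le_mul_of_nonneg_left (h1.trans ?_) t.coe_nonneg
          gcongr
      _ = _ := by ring
  · intro t f
    have h1 := (hV.dist_le_mul (clipArc a b ha hb hab V t f) f).trans
      (mul_le_mul_of_nonneg_left (hself t f) K.coe_nonneg)
    rw [dist_eq_norm] at h1
    have h2 : ‖V (clipArc a b ha hb hab V t f)‖ ≤
        ‖V (clipArc a b ha hb hab V t f) - V f‖ + ‖V f‖ := by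
      simpa using norm_add_le (V (clipArc a b ha hb hab V t f) - V f) (V f)
    linarith

theorem isLocallyLipschitzArc_clipArc (ha : Measurable a) (hb : Measurable b)
    (hab : 0 < ⨅ x, (b x - a x)) {V : Between a b → BddMeas S} (hV : LocallyLipschitz V) :
    IsLocallyLipschitzArc (clipArc a b ha hb hab V) := by
  intro C hC
  obtain ⟨K, V', hV', U, hU, hCU, heq⟩ := exists_lipschitzWith_eqOn_of_isCompact hV hC
  refine ⟨clipArc a b ha hb hab V', _, K, isLipschitzArc_clipArc ha hb hab hV', U, hU, hCU,
    fun f hf t => ?_⟩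
  simp only [clipArc, heq hf]

end ClipArc
end ArcField

theorem mainTheorem2 {S : Type*} [MeasurableSpace S] (a b : S → EReal)
    (ha : Measurable a) (hb : Measurable b) (hab : 0 < ⨅ x, (b x - a x))
    (V : Between a b → BddMeas S) (hV : LocallyLipschitz V) :
    IsArcField (clipArc a b ha hb hab V) ∧
    CondE1 (clipArc a b ha hb hab V) ∧
    CondE2 (clipArc a b ha hb hab V) ∧
    ∃ (T : Between a b → ℝ≥0∞) (F : ℝ≥0 → Between a b → Between a b),
      IsLocalFlowOf (clipArc a b ha hb hab V) T F ∧
      (∀ (T' : Between a b → ℝ≥0∞) (F' : ℝ≥0 → Between a b → Between a b),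
        IsLocalFlowOf (clipArc a b ha hb hab V) T' F' →
          ∀ f, T' f ≤ T f ∧ ∀ t : ℝ≥0, (t : ℝ≥0∞) < T' f → F' t f = F t f) ∧
      (∀ (f : Between a b) (t : ℝ≥0), (t : ℝ≥0∞) < T f →
        Tendsto (fun n : ℕ => (clipArc a b ha hb hab V (t / (n : ℝ≥0)))^[n] f)
          atTop (𝓝 (F t f))) ∧
      ((∃ K : ℝ≥0, LipschitzWith K V) →
        (∀ f, T f = ∞) ∧
        IsFlowOf (clipArc a b ha hb hab V) F ∧
        ∀ G : ℝ≥0 → Between a b → Between a b,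
          IsFlowOf (clipArc a b ha hb hab V) G → G = F) := by
  have hX := isLocallyLipschitzArc_clipArc ha hb hab hV
  have hE := hX.condE1
  refine ⟨hX.isArcField, hE, hX.condE2, lifetime _, maxFlow _, hX.isLocalFlowOf,
    fun T' F' h f => ⟨h.le_lifetime f, fun t ht => h.eq_maxFlow hE ht⟩, fun f t ht => ?_, ?_⟩
  · obtain ⟨_, _, _, _, _, _, _, hlim⟩ := hX.exists_flow_near_of_lt ht
    exact hlim
  · rintro ⟨K, hK⟩
    -- For globally Lipschitz `V` no cutoff is needed: the Euler flow of `X` itself is global, and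
    -- the maximal flow must extend it.
    have hflow := (isLipschitzArc_clipArc ha hb hab hK).isFlowOf
    refine ⟨fun f => top_le_iff.1 (hflow.isLocalFlowOf.le_lifetime f), ?_,
      fun G hG => hG.eq_maxFlow hE⟩
    rw [← hflow.eq_maxFlow hE]
    exact hflow
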